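/- All graphs are finite, simple and connected. For a matching $M$ of a graph $G$ let $V(M)$ be the set of vertices that it covers; matchings may be empty, and maximum matchings are those with the largest number of edges. A $k$-matching cover of $G$ is a union of $k$ matchings of $G$ that covers $V(G)$; $mc(G)$ is the least $k$ for which one exists, and a $k$-matching cover is optimal if $k=mc(G)$. Let $D(G)$ be the set of vertices that are left uncovered by some maximum matching of $G$, let $A(G)$ be the set of vertices outside $D(G)$ that have a neighbour in $D(G)$, and let $C(G)=V(G)\setminus(A(G)\cup D(G))$. Let $D^*$ be the set of isolated vertices of the induced subgraph $G[D(G)]$, and let $G^*$ be the (bipartite) graph with vertex set $A(G)\cup D^*$ obtained from $G$ by deleting the nontrivial components of $G[D(G)]$, the vertices of $C(G)$, and the edges with both ends in $A(G)$. A $k$-matching $D^*$-cover of $G^*$ is a union of $k$ matchings of $G^*$ that covers $D^*$; $md(G^*)$ is the least $k$ for which one exists, and a $k$-matching $D^*$-cover is optimal if $k=md(G^*)$. Let $G$ be a graph with $A(G)\neq\emptyset$, let $k=md(G^*)$, and let $\bigcup_{i=1}^k N_i$ be an optimal matching $D^*$-cover of $G^*$, where each $N_i$ is a matching of $G^*$.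 (i) If $k=0$, then for every maximum matching $M_1$ of $G$ there is a matching $N'$ of $G[D(G)]$ such that $M_1\cup N'$ is an optimal matching cover of $G$ (with $mc(G)=2$). (ii) If $k=1$, then there are a maximum matching $M_1$ of $G$ with $V(N_1)\subseteq V(M_1)$ and a matching $N'$ of $G[D(G)]$ such that $M_1\cup N'$ is an optimal matching cover of $G$ (with $mc(G)=2$). (iii) If $k\ge 2$, then $G$ has an optimal matching cover $\bigcup_{i=1}^k M_i$ (with $mc(G)=k$), where each $M_i$ is a matching of $G$, such that $M_1$ is a maximum matching of $G$ with $V(N_1)\subseteq V(M_1)$, $M_2=N_2\cup N'$ for some matching $N'$ of $G[D(G)]$, and $M_i=N_i$ for $3\le i\le k$. -/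

import Mathlib

/-! Matchings are Mathlib's: a subgraph `M` of `G` with `M.IsMatching`. Every vertex of such an `M`
lies on an edge of `M`, so `M.verts` is the set of vertices that `M` covers, `M` is determined by
its edge set, and unions of matchings are suprema of subgraphs. A matching of a subgraph `H` of `G`
is a matching `M` with `M ≤ H`. The empty matching `⊥` is allowed. -/

namespace SimpleGraph

variable {V : Type*}

/-- A matching with the largest number of edges (intended for finite `V`). -/
def IsMaximumMatching (G : SimpleGraph V) (M : G.Subgraph) : Prop :=
  M.IsMatching ∧ ∀ M' : G.Subgraph, M'.IsMatching → M'.edgeSet.ncard ≤ M.edgeSet.ncard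

/-- `M` is a `k`-matching cover of `G`: a union of `k` matchings of `G` that covers `V(G)`. -/
def IsMatchingCover (G : SimpleGraph V) (k : ℕ) (M : G.Subgraph) : Prop :=
  (∃ P : Fin k → G.Subgraph, (∀ i, (P i).IsMatching) ∧ M = ⨆ i, P i) ∧
    ∀ v : V, v ∈ M.verts

/-- `mc(G)`, the least `k` such that `G` has a `k`-matching cover. -/
noncomputable def matchingCoverNumber (G : SimpleGraph V) : ℕ :=
  sInf {k | ∃ M : G.Subgraph, G.IsMatchingCover k M}

/-- A `k`-matching cover is optimal if `k = mc(G)`. -/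
def IsOptimalMatchingCover (G : SimpleGraph V) (k : ℕ) (M : G.Subgraph) : Prop :=
  G.IsMatchingCover k M ∧ k = G.matchingCoverNumber

/-- `D(G)`: the vertices that some maximum matching of `G` does not cover. -/
def gallaiD (G : SimpleGraph V) : Set V :=
  {v | ∃ M : G.Subgraph, G.IsMaximumMatching M ∧ v ∉ M.verts}

/-- `A(G) = N_G(D(G))`: the vertices outside `D(G)` with a neighbour in `D(G)`. -/
def gallaiA (G : SimpleGraph V) : Set V :=
  {v | v ∉ G.gallaiD ∧ ∃ u ∈ G.gallaiD, G.Adj u v}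

/-- The subgraph `G[D(G)]` of `G` induced by `D(G)`. -/
def gallaiDGraph (G : SimpleGraph V) : G.Subgraph :=
  (⊤ : G.Subgraph).induce G.gallaiD

/-- `D*`: the isolated vertices of `G[D(G)]`. -/
def gallaiDStar (G : SimpleGraph V) : Set V :=
  {v | v ∈ G.gallaiDGraph.verts ∧ ∀ u : V, ¬ G.gallaiDGraph.Adj v u}

/-- `G*`: delete from `G` the nontrivial components of `G[D(G)]` (their vertices are those of
`D(G) \ D*`), the vertices of `C(G) = V(G) \ (A(G) ∪ D(G))`, and the edges spanned by `A(G)`.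
The remaining vertices are those of `A(G) ∪ D*`. -/
def gallaiStar (G : SimpleGraph V) : G.Subgraph :=
  ((⊤ : G.Subgraph).induce (G.gallaiA ∪ G.gallaiDStar)).deleteEdges
    ((⊤ : G.Subgraph).induce G.gallaiA).edgeSet

/-- `M` is a `k`-matching `D*`-cover of `G*`: a union of `k` matchings of `G*` that covers `D*`. -/
def IsMatchingDStarCover (G : SimpleGraph V) (k : ℕ) (M : G.Subgraph) : Prop :=
  (∃ P : Fin k → G.Subgraph, (∀ i, (P i).IsMatching ∧ P i ≤ G.gallaiStar) ∧ M = ⨆ i, P i) ∧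
    G.gallaiDStar ⊆ M.verts

/-- `md(G*)`, the least `k` such that `G*` has a `k`-matching `D*`-cover. -/
noncomputable def matchingDStarCoverNumber (G : SimpleGraph V) : ℕ :=
  sInf {k | ∃ M : G.Subgraph, G.IsMatchingDStarCover k M}

/-- A `k`-matching `D*`-cover of `G*` is optimal if `k = md(G*)`. -/
def IsOptimalMatchingDStarCover (G : SimpleGraph V) (k : ℕ) (M : G.Subgraph) : Prop :=
  G.IsMatchingDStarCover k M ∧ k = G.matchingDStarCoverNumber

end SimpleGraph

/-!
The argument uses only two facts about maximum matchings, both obtained by exchanging an edge `yz`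
of a maximum matching for an edge `xy`, where `x` is a vertex that it misses
(`IsMaximumMatching.exists_exchange_toward`).

* For every matching `N`, a maximum matching that shares as many edges with `N` as possible covers
  all vertices of `N`.
* Two vertices missed by the same maximum matching have no common neighbour in `D(G)`. This is the
  part of Gallai's lemma that the proof needs, so the Gallai-Edmonds structure theorem is not used.

Let `M₁` be a maximum matching. It misses only vertices of `D(G)`, and each missed vertex outside
`D*` has a neighbour in `D(G)`. By the second fact (and since missed vertices are pairwise
nonadjacent) an arbitrary choice of such neighbours gives a matching `N'` of `G[D(G)]` that covers
the missed vertices outside `D*`. The first fact lets `M₁` cover `V(N₁)`; then the missed vertices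
in `D*` are covered by `N₂, …, N_k`. Since `N'` avoids `A(G) ∪ D*`, it is disjoint from `N₂`.

For optimality, all edges at a vertex of `D*` are edges of `G*`, so a `k`-matching cover of `G`
restricts to a `k`-matching `D*`-cover of `G*`, whence `md(G*) ≤ mc(G)`; and `mc(G) ≥ 2` because
`D(G)` is nonempty, so that `G` has no perfect matching.
-/

namespace SimpleGraph

variable {V : Type*} {G : SimpleGraph V}

/-! ### Exchanging edges of a matching -/

/-- The handshaking lemma for matchings. -/
lemma Subgraph.IsMatching.ncard_verts [Finite V] {M : G.Subgraph} (hM : M.IsMatching) :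
    M.verts.ncard = 2 * M.edgeSet.ncard := by
  classical
  have := Fintype.ofFinite V
  have h := M.spanningCoe.sum_degrees_eq_twice_card_edges
  rw [← Set.ncard_coe_finset M.spanningCoe.edgeFinset, coe_edgeFinset,
    Subgraph.edgeSet_spanningCoe] at h
  have hdeg : ∀ v, M.spanningCoe.degree v = if v ∈ M.verts then 1 else 0 := by
    intro v
    split_ifs with hv
    · rw [SimpleGraph.degree_eq_one_iff_existsUnique_adj]
      exact hM hv
    · rw [degree_eq_zero]
      exact fun w hw => hv (Subgraph.Adj.fst_mem hw)
  rw [← h, Set.ncard_eq_toFinset_card', Finset.sum_congr rfl fun v _ => hdeg v,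
    Finset.sum_boole, Nat.cast_id]
  congr 1
  ext v
  simp

/-- Adding to a matching an edge between two vertices that it misses. -/
lemma Subgraph.IsMatching.exists_insert {M : G.Subgraph} (hM : M.IsMatching) {v w : V}
    (hvw : G.Adj v w) (hv : v ∉ M.verts) (hw : w ∉ M.verts) :
    ∃ M' : G.Subgraph, M'.IsMatching ∧ M'.edgeSet = insert s(v, w) M.edgeSet := by
  refine ⟨M ⊔ G.subgraphOfAdj hvw, hM.sup (.subgraphOfAdj hvw) ?_, ?_⟩
  · rw [hM.support_eq_verts, support_subgraphOfAdj]
    simp [hv, hw]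
  · simp [Set.union_comm]

/-- Replacing in a matching the edge `wx` by an edge `vw`, where the matching misses `v`. -/
lemma Subgraph.IsMatching.exists_exchange {M : G.Subgraph} (hM : M.IsMatching) {v w x : V}
    (hvw : G.Adj v w) (hv : v ∉ M.verts) (hwx : M.Adj w x) :
    ∃ M' : G.Subgraph, M'.IsMatching ∧ M'.verts ⊆ insert v M.verts ∧
      M'.edgeSet = insert s(v, w) (M.edgeSet \ {s(w, x)}) := by
  have key : ∀ a b, M.Adj a b → s(a, b) ≠ s(w, x) → a ≠ w ∧ a ≠ x ∧ b ≠ w ∧ b ≠ x := by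
    intro a b hab hne
    refine ⟨?_, ?_, ?_, ?_⟩
    · rintro rfl; exact hne (by rw [hM.eq_of_adj_left hab hwx])
    · rintro rfl; exact hne (by rw [hM.eq_of_adj_left hab hwx.symm, Sym2.eq_swap])
    · rintro rfl; exact hne (by rw [hM.eq_of_adj_left hab.symm hwx, Sym2.eq_swap])
    · rintro rfl; exact hne (by rw [hM.eq_of_adj_left hab.symm hwx.symm])
  have hdel : (M.deleteVerts {w, x}).IsMatching := by
    rintro a ⟨ha, hna⟩
    obtain ⟨b, hb, hu⟩ := hM ha
    have hne : s(a, b) ≠ s(w, x) := by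
      intro h
      have : a ∈ s(w, x) := h ▸ Sym2.mem_mk_left a b
      exact hna (by simpa using this)
    obtain ⟨h1, h2, h3, h4⟩ := key a b hb hne
    refine ⟨b, ?_, fun c hc => hu c (Subgraph.deleteVerts_le.2 hc)⟩
    simp [ha, hb, h1, h2, h3, h4, hb.snd_mem]
  refine ⟨M.deleteVerts {w, x} ⊔ G.subgraphOfAdj hvw, hdel.sup (.subgraphOfAdj hvw) ?_, ?_, ?_⟩
  · rw [hdel.support_eq_verts, support_subgraphOfAdj]
    simp [hv]
  · rintro a (ha | ha)
    · exact .inr ha.1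
    · obtain rfl | rfl := ha
      · exact .inl rfl
      · exact .inr hwx.fst_mem
  · rw [Subgraph.edgeSet_sup, edgeSet_subgraphOfAdj, Set.union_comm, Set.singleton_union]
    congr 1
    ext e
    induction e with | _ a b
    simp only [Subgraph.mem_edgeSet, Subgraph.deleteVerts_adj, Set.mem_sdiff,
      Set.mem_singleton_iff, Set.mem_insert_iff, not_or]
    constructor
    · rintro ⟨-, ⟨h1, h2⟩, -, -, hab⟩
      refine ⟨hab, fun h => ?_⟩
      have : a ∈ s(w, x) := h ▸ Sym2.mem_mk_left a b
      simp_all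
    · rintro ⟨hab, hne⟩
      obtain ⟨h1, h2, h3, h4⟩ := key a b hab hne
      exact ⟨hab.fst_mem, ⟨h1, h2⟩, hab.snd_mem, ⟨h3, h4⟩, hab⟩

/-! ### Maximum matchings -/

lemma exists_isMaximumMatching [Finite V] (G : SimpleGraph V) :
    ∃ M : G.Subgraph, G.IsMaximumMatching M := by
  obtain ⟨M, hM, hmax⟩ := Set.exists_max_image {M : G.Subgraph | M.IsMatching}
    (fun M => M.edgeSet.ncard) (Set.toFinite _) ⟨⊥, fun v hv => hv.elim⟩
  exact ⟨M, hM, hmax⟩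

lemma IsMaximumMatching.mem_verts_of_adj [Finite V] {M : G.Subgraph} (hM : G.IsMaximumMatching M)
    {v w : V} (hvw : G.Adj v w) (hv : v ∉ M.verts) : w ∈ M.verts := by
  by_contra hw
  obtain ⟨M', hM', he⟩ := hM.1.exists_insert hvw hv hw
  have hnot : s(v, w) ∉ M.edgeSet := fun h => hv (Subgraph.Adj.fst_mem h)
  have := hM.2 M' hM'
  rw [he, Set.ncard_insert_of_notMem hnot] at this
  lia

/-- If a maximum matching `M` misses a vertex `x` that a matching `N` covers, an exchange at `x`
makes the intersection of `M` with `N` larger, and `x` is the only vertex that may be newly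
covered. -/
lemma IsMaximumMatching.exists_exchange_toward [Finite V] {M N : G.Subgraph}
    (hM : G.IsMaximumMatching M) (hN : N.IsMatching) {x : V} (hxN : x ∈ N.verts)
    (hxM : x ∉ M.verts) :
    ∃ M' : G.Subgraph, G.IsMaximumMatching M' ∧ M'.verts ⊆ insert x M.verts ∧
      (M.edgeSet ∩ N.edgeSet).ncard < (M'.edgeSet ∩ N.edgeSet).ncard := by
  obtain ⟨y, hxy, -⟩ := hN hxN
  obtain ⟨z, hyz, -⟩ := hM.1 (hM.mem_verts_of_adj hxy.adj_sub hxM)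
  obtain ⟨M', hM', hsub, he⟩ := hM.1.exists_exchange hxy.adj_sub hxM hyz
  have hnot : s(x, y) ∉ M.edgeSet := fun h => hxM (Subgraph.Adj.fst_mem h)
  have hyzN : s(y, z) ∉ N.edgeSet := fun h =>
    hxM (hN.eq_of_adj_left hxy.symm h ▸ hyz.snd_mem)
  refine ⟨M', ⟨hM', fun L hL => ?_⟩, hsub, ?_⟩
  · rw [he, Set.ncard_insert_of_notMem fun h => hnot h.1,
      Set.ncard_sdiff_singleton_add_one (show s(y, z) ∈ M.edgeSet from hyz)]
    exact hM.2 L hL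
  · refine Set.ncard_lt_ncard ?_
    rw [Set.ssubset_iff_of_subset]
    · exact ⟨s(x, y), ⟨he ▸ .inl rfl, hxy⟩, fun h => hnot h.1⟩
    · rintro e ⟨h1, h2⟩
      exact ⟨he ▸ .inr ⟨h1, fun h => hyzN (h ▸ h2)⟩, h2⟩

/-- Every matching is covered, as a set of vertices, by some maximum matching: one that shares as
many edges with it as possible. -/
lemma Subgraph.IsMatching.exists_isMaximumMatching_verts_subset [Finite V] {N : G.Subgraph}
    (hN : N.IsMatching) : ∃ M : G.Subgraph, G.IsMaximumMatching M ∧ N.verts ⊆ M.verts := by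
  obtain ⟨M, hM, hmax⟩ := Set.exists_max_image {M : G.Subgraph | G.IsMaximumMatching M}
    (fun M => (M.edgeSet ∩ N.edgeSet).ncard) (Set.toFinite _) G.exists_isMaximumMatching
  refine ⟨M, hM, fun x hxN => ?_⟩
  by_contra hxM
  obtain ⟨M', hM', -, hlt⟩ := hM.exists_exchange_toward hN hxN hxM
  exact (hmax M' hM').not_gt hlt

lemma IsMaximumMatching.ncard_verts_eq [Finite V] {M N : G.Subgraph} (hM : G.IsMaximumMatching M)
    (hN : G.IsMaximumMatching N) : M.verts.ncard = N.verts.ncard := by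
  rw [hM.1.ncard_verts, hN.1.ncard_verts, (hN.2 M hM.1).antisymm (hM.2 N hN.1)]

/-- The case of Gallai's lemma that is needed: two vertices missed by the same maximum matching
have no common neighbour in `D(G)`. -/
lemma IsMaximumMatching.notMem_gallaiD [Finite V] {M : G.Subgraph} (hM : G.IsMaximumMatching M)
    {u v t : V} (huv : u ≠ v) (hu : u ∉ M.verts) (hv : v ∉ M.verts) (hut : G.Adj u t)
    (hvt : G.Adj v t) : t ∉ G.gallaiD := by
  intro ht
  -- Among the maximum matchings that miss `t`, one that shares as many edges with `M` as possible.
  obtain ⟨N, ⟨hN, htN⟩, hmax⟩ := Set.exists_max_image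
    {N : G.Subgraph | G.IsMaximumMatching N ∧ t ∉ N.verts}
    (fun N => (N.edgeSet ∩ M.edgeSet).ncard) (Set.toFinite _) ht
  have huN := hN.mem_verts_of_adj hut.symm htN
  have hvN := hN.mem_verts_of_adj hvt.symm htN
  -- `N` covers `u` and `v`, which `M` misses, so by counting `M` covers two vertices that `N`
  -- misses, one of them other than `t`.
  have hcard : 1 < (M.verts \ N.verts).ncard := by
    have h1 := Set.ncard_inter_add_ncard_sdiff_eq_ncard M.verts N.verts
    have h2 := Set.ncard_inter_add_ncard_sdiff_eq_ncard N.verts M.verts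
    have h3 := hM.ncard_verts_eq hN
    have h4 : ({u, v} : Set V).ncard ≤ (N.verts \ M.verts).ncard := by
      refine Set.ncard_le_ncard ?_
      rintro a (rfl | rfl)
      exacts [⟨huN, hu⟩, ⟨hvN, hv⟩]
    rw [Set.ncard_pair huv] at h4
    rw [Set.inter_comm] at h2
    lia
  obtain ⟨x, ⟨hxM, hxN⟩, hxt⟩ := Set.exists_ne_of_one_lt_ncard hcard t
  obtain ⟨N', hN', hsub, hlt⟩ := hN.exists_exchange_toward hM.1 hxM hxN
  refine (hmax N' ⟨hN', fun h => ?_⟩).not_gt hlt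
  obtain h | h := hsub h
  exacts [hxt h.symm, htN h]

/-- The vertices of nontrivial components of `G[D(G)]` that a maximum matching misses are covered
by a matching of `G[D(G)]`: match each of them with any neighbour in `D(G)`. -/
lemma IsMaximumMatching.exists_isMatching_gallaiDGraph [Finite V] {M : G.Subgraph}
    (hM : G.IsMaximumMatching M) :
    ∃ N : G.Subgraph, N.IsMatching ∧ N ≤ G.gallaiDGraph ∧
      ∀ v, v ∉ M.verts → v ∉ G.gallaiDStar → v ∈ N.verts := by
  have hex : ∀ v : {v // v ∉ M.verts ∧ v ∉ G.gallaiDStar}, ∃ w, G.gallaiDGraph.Adj v w := by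
    rintro ⟨v, hv, hvs⟩
    by_contra! h
    exact hvs ⟨⟨M, hM, hv⟩, h⟩
  choose f hf using hex
  refine ⟨⨆ v, G.subgraphOfAdj (hf v).adj_sub, .iSup (fun v => .subgraphOfAdj _) ?_, ?_, ?_⟩
  · intro v w hvw
    have hne : (v : V) ≠ w := fun h => hvw (Subtype.ext h)
    simp only [support_subgraphOfAdj, Set.disjoint_left]
    rintro a (rfl | rfl) (h | h)
    · exact hne h
    · exact w.2.1 (hM.mem_verts_of_adj (h ▸ (hf w).adj_sub.symm) v.2.1)
    · exact v.2.1 (hM.mem_verts_of_adj (h ▸ (hf v).adj_sub).symm w.2.1)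
    · have h : f v = f w := h
      exact hM.notMem_gallaiD hne v.2.1 w.2.1 (hf v).adj_sub (h ▸ (hf w).adj_sub)
        (hf v).snd_mem
  · exact iSup_le fun v => subgraphOfAdj_le_of_adj _ (hf v)
  · intro v hv hvs
    rw [Subgraph.verts_iSup]
    exact Set.mem_iUnion.2 ⟨⟨v, hv, hvs⟩, .inl rfl⟩

/-! ### Matching covers of `G` and matching `D*`-covers of `G*` -/

lemma isMatchingCover_two {M N : G.Subgraph} (hM : M.IsMatching) (hN : N.IsMatching)
    (h : ∀ v, v ∈ M.verts ∨ v ∈ N.verts) : G.IsMatchingCover 2 (M ⊔ N) := by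
  refine ⟨⟨![M, N], ?_, ?_⟩, h⟩
  · intro i
    fin_cases i
    exacts [hM, hN]
  · refine le_antisymm (sup_le (le_iSup ![M, N] 0) (le_iSup ![M, N] 1)) (iSup_le fun i => ?_)
    fin_cases i
    exacts [le_sup_left, le_sup_right]

lemma isMatchingCover_biSup {k : ℕ} {M : ℕ → G.Subgraph}
    (hM : ∀ i ∈ Finset.Icc 1 k, (M i).IsMatching)
    (h : ∀ v, ∃ i ∈ Finset.Icc 1 k, v ∈ (M i).verts) :
    G.IsMatchingCover k (⨆ i ∈ Finset.Icc 1 k, M i) := by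
  refine ⟨⟨fun i => M (i + 1), fun i => hM _ (by simp), ?_⟩, fun v => ?_⟩
  · refine le_antisymm (iSup₂_le fun i hi => ?_) (iSup_le fun i => ?_)
    · rw [Finset.mem_Icc] at hi
      have := le_iSup (fun i : Fin k => M (i + 1)) ⟨i - 1, by lia⟩
      simpa [Nat.sub_add_cancel hi.1] using this
    · exact le_iSup₂_of_le (i + 1 : ℕ) (by simp) le_rfl
  · obtain ⟨i, hi, hv⟩ := h v
    exact (le_iSup₂_of_le i hi le_rfl : M i ≤ _).1 hv

/-- A matching restricts to a matching of any subgraph `H`; a vertex stays covered if its matching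
edge lies in `H`. -/
lemma Subgraph.IsMatching.exists_isMatching_le {M : G.Subgraph} (hM : M.IsMatching)
    (H : G.Subgraph) : ∃ N : G.Subgraph, N.IsMatching ∧ N ≤ H ∧
      ∀ v w, M.Adj v w → H.Adj v w → v ∈ N.verts := by
  refine ⟨(M ⊓ H).induce (M ⊓ H).support, ?_, ?_, ?_⟩
  · rintro v ⟨w, hw⟩
    refine ⟨w, ⟨⟨w, hw⟩, ⟨v, Subgraph.Adj.symm (G' := M ⊓ H) hw⟩, hw⟩,
      fun x hx => hM.eq_of_adj_left hx.2.2.1 hw.1⟩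
  · refine ⟨?_, fun v w h => h.2.2.2⟩
    rintro v ⟨w, hw⟩
    exact hw.2.fst_mem
  · intro v w h1 h2
    exact ⟨w, h1, h2⟩

/-- All neighbours of a vertex of `D*` lie in `A(G)`, so all edges at such a vertex are edges of
`G*`. -/
lemma gallaiStar_adj_of_mem_gallaiDStar {v w : V} (hv : v ∈ G.gallaiDStar) (hvw : G.Adj v w) :
    G.gallaiStar.Adj v w := by
  have hvD : v ∈ G.gallaiD := hv.1
  have hwD : w ∉ G.gallaiD := fun h => hv.2 w ⟨hvD, h, hvw⟩
  refine (Subgraph.deleteEdges_adj _ _ _).2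
    ⟨⟨.inr hv, .inl ⟨hwD, v, hvD, hvw⟩, hvw⟩, fun h => ?_⟩
  exact (Subgraph.mem_edgeSet.1 h).1.1 hvD

/-- Restricting the matchings of a matching cover of `G` to `G*` gives a matching `D*`-cover. -/
lemma IsMatchingCover.matchingDStarCoverNumber_le {k : ℕ} {M : G.Subgraph}
    (hM : G.IsMatchingCover k M) : G.matchingDStarCoverNumber ≤ k := by
  obtain ⟨⟨P, hP, rfl⟩, hcov⟩ := hM
  choose Q hQ hQle hQv using fun i => (hP i).exists_isMatching_le G.gallaiStar
  refine Nat.sInf_le ⟨⨆ i, Q i, ⟨Q, fun i => ⟨hQ i, hQle i⟩, rfl⟩, fun v hv => ?_⟩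
  have h := hcov v
  rw [Subgraph.verts_iSup, Set.mem_iUnion] at h ⊢
  obtain ⟨i, hi⟩ := h
  obtain ⟨w, hw, -⟩ := hP i hi
  exact ⟨i, hQv i v w hw (gallaiStar_adj_of_mem_gallaiDStar hv hw.adj_sub)⟩

/-- If `D(G)` is nonempty, then `G` has no perfect matching, so one matching does not cover `G`. -/
lemma IsMatchingCover.two_le [Finite V] (hD : G.gallaiD.Nonempty) {k : ℕ} {M : G.Subgraph}
    (hM : G.IsMatchingCover k M) : 2 ≤ k := by
  obtain ⟨⟨P, hP, rfl⟩, hcov⟩ := hM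
  obtain ⟨v, L, hL, hv⟩ := hD
  by_contra! hk
  have hunique : ∀ i j : Fin k, i = j := fun i j => Fin.ext (by lia)
  obtain ⟨i, -⟩ : ∃ i, v ∈ (P i).verts := by
    simpa [Subgraph.verts_iSup] using hcov v
  have huniv : (P i).verts = Set.univ := by
    refine Set.eq_univ_of_forall fun w => ?_
    obtain ⟨j, hj⟩ : ∃ j, w ∈ (P j).verts := by
      simpa [Subgraph.verts_iSup] using hcov w
    exact hunique j i ▸ hj
  have h1 := (hP i).ncard_verts
  have h2 := hL.1.ncard_verts
  have h3 := hL.2 _ (hP i)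
  have h4 : L.verts.ncard < (P i).verts.ncard := by
    rw [huniv]
    exact Set.ncard_lt_ncard (Set.ssubset_univ_iff.2 fun h => hv (h ▸ Set.mem_univ v))
  lia

lemma IsMatchingCover.isOptimalMatchingCover {k : ℕ} {M : G.Subgraph} (hM : G.IsMatchingCover k M)
    (hk : ∀ m (L : G.Subgraph), G.IsMatchingCover m L → k ≤ m) :
    G.IsOptimalMatchingCover k M :=
  ⟨hM, le_antisymm (le_csInf ⟨k, M, hM⟩ fun m ⟨L, hL⟩ => hk m L hL) (Nat.sInf_le ⟨M, hM⟩)⟩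

/-- Matchings of `G*` and of `G[D(G)]` share no vertices: the former live on `A(G) ∪ D*`, the
latter on the nontrivial components of `G[D(G)]`. -/
lemma disjoint_verts_of_le_gallaiStar {M N : G.Subgraph} (hM : M ≤ G.gallaiStar)
    (hN : N.IsMatching) (hND : N ≤ G.gallaiDGraph) : Disjoint M.verts N.verts := by
  rw [Set.disjoint_left]
  intro v hvM hvN
  obtain ⟨w, hw, -⟩ := hN hvN
  obtain h | h : v ∈ G.gallaiA ∪ G.gallaiDStar := hM.1 hvM
  · exact h.1 (hND.2 hw).1
  · exact h.2 w (hND.2 hw)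

end SimpleGraph

open SimpleGraph in
theorem mainTheorem3 {V : Type*} [Finite V] (G : SimpleGraph V) (hG : G.Connected)
    (hA : G.gallaiA.Nonempty) (k : ℕ) (N : ℕ → G.Subgraph)
    (hN : ∀ i ∈ Finset.Icc 1 k, (N i).IsMatching ∧ N i ≤ G.gallaiStar)
    (hopt : G.IsOptimalMatchingDStarCover k (⨆ i ∈ Finset.Icc 1 k, N i)) :
    (k = 0 → ∀ M₁ : G.Subgraph, G.IsMaximumMatching M₁ →
      ∃ N' : G.Subgraph, N'.IsMatching ∧ N' ≤ G.gallaiDGraph ∧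
        G.IsOptimalMatchingCover 2 (M₁ ⊔ N')) ∧
    (k = 1 → ∃ M₁ N' : G.Subgraph, G.IsMaximumMatching M₁ ∧ (N 1).verts ⊆ M₁.verts ∧
      N'.IsMatching ∧ N' ≤ G.gallaiDGraph ∧ G.IsOptimalMatchingCover 2 (M₁ ⊔ N')) ∧
    (2 ≤ k → ∃ M : ℕ → G.Subgraph, (∀ i ∈ Finset.Icc 1 k, (M i).IsMatching) ∧
      G.IsOptimalMatchingCover k (⨆ i ∈ Finset.Icc 1 k, M i) ∧
      G.IsMaximumMatching (M 1) ∧ (N 1).verts ⊆ (M 1).verts ∧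
      (∃ N' : G.Subgraph, N'.IsMatching ∧ N' ≤ G.gallaiDGraph ∧ M 2 = N 2 ⊔ N') ∧
      ∀ i, 3 ≤ i → i ≤ k → M i = N i) := by
  have hD : G.gallaiD.Nonempty := by
    obtain ⟨a, -, u, hu, -⟩ := hA
    exact ⟨u, hu⟩
  have hstar : ∀ v ∈ G.gallaiDStar, ∃ i ∈ Finset.Icc 1 k, v ∈ (N i).verts := by
    intro v hv
    have := hopt.1.2 hv
    simp only [Subgraph.verts_iSup, Set.mem_iUnion] at this
    obtain ⟨i, hi, h⟩ := this
    exact ⟨i, hi, h⟩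
  have htwo : ∀ M N' : G.Subgraph, M.IsMatching → N'.IsMatching →
      (∀ v, v ∈ M.verts ∨ v ∈ N'.verts) → G.IsOptimalMatchingCover 2 (M ⊔ N') :=
    fun M N' hM hN' h =>
      (isMatchingCover_two hM hN' h).isOptimalMatchingCover fun _ _ hL => hL.two_le hD
  refine ⟨?_, ?_, fun hk => ?_⟩
  · rintro rfl M₁ hM₁
    obtain ⟨N', hN', hle, hcov⟩ := hM₁.exists_isMatching_gallaiDGraph
    refine ⟨N', hN', hle, htwo _ _ hM₁.1 hN' fun v => or_iff_not_imp_left.2 fun hv => ?_⟩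
    refine hcov v hv fun hvs => ?_
    obtain ⟨i, hi, -⟩ := hstar v hvs
    simp at hi
  · rintro rfl
    obtain ⟨M₁, hM₁, hsub⟩ := (hN 1 (by simp)).1.exists_isMaximumMatching_verts_subset
    obtain ⟨N', hN', hle, hcov⟩ := hM₁.exists_isMatching_gallaiDGraph
    refine ⟨M₁, N', hM₁, hsub, hN', hle,
      htwo _ _ hM₁.1 hN' fun v => or_iff_not_imp_left.2 fun hv => hcov v hv fun hvs => hv ?_⟩
    obtain ⟨i, hi, h⟩ := hstar v hvs
    obtain rfl : i = 1 := by simpa using hi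
    exact hsub h
  · obtain ⟨M₁, hM₁, hsub⟩ := (hN 1 (by simp; lia)).1.exists_isMaximumMatching_verts_subset
    obtain ⟨N', hN', hle, hcov⟩ := hM₁.exists_isMatching_gallaiDGraph
    have hN2 := hN 2 (by simp; lia)
    have hM₂ : (N 2 ⊔ N').IsMatching := hN2.1.sup hN' <| by
      rw [hN2.1.support_eq_verts, hN'.support_eq_verts]
      exact disjoint_verts_of_le_gallaiStar hN2.2 hN' hle
    let M : ℕ → G.Subgraph := fun i => if i = 1 then M₁ else if i = 2 then N 2 ⊔ N' else N i
    have hM3 : ∀ i, 3 ≤ i → M i = N i := fun i hi => by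
      simp only [M, if_neg (show i ≠ 1 by lia), if_neg (show i ≠ 2 by lia)]
    have hMm : ∀ i ∈ Finset.Icc 1 k, (M i).IsMatching := by
      intro i hi
      obtain rfl | rfl | h : i = 1 ∨ i = 2 ∨ 3 ≤ i := by
        have := (Finset.mem_Icc.1 hi).1
        lia
      exacts [hM₁.1, hM₂, hM3 i h ▸ (hN i hi).1]
    have hNM : ∀ i ∈ Finset.Icc 1 k, (N i).verts ⊆ (M i).verts := by
      intro i hi
      obtain rfl | rfl | h : i = 1 ∨ i = 2 ∨ 3 ≤ i := by
        have := (Finset.mem_Icc.1 hi).1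
        lia
      exacts [hsub, Set.subset_union_left, (hM3 i h).symm ▸ subset_rfl]
    refine ⟨M, hMm, (isMatchingCover_biSup hMm fun v => ?_).isOptimalMatchingCover
      fun m L hL => hopt.2.trans_le hL.matchingDStarCoverNumber_le, hM₁, hsub,
      ⟨N', hN', hle, rfl⟩, fun i hi _ => hM3 i hi⟩
    by_cases hv : v ∈ M₁.verts
    · exact ⟨1, by simp; lia, hv⟩
    by_cases hvs : v ∈ G.gallaiDStar
    · obtain ⟨i, hi, h⟩ := hstar v hvs
      exact ⟨i, hi, hNM i hi h⟩
    · exact ⟨2, by simp; lia, .inr (hcov v hv hvs)⟩
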